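/- For every $\eta>0$ there is a constant $c=c(\eta)>0$ such that the following holds. Let $A$ be a real number and let $d:\mathbb N\to\mathbb N$ satisfy $d(n)=o(n)$. Then there is $n_0$ (depending on $\eta$, $A$ and $d$) such that for all $n\ge n_0$ and all $\varepsilon$ with $2^{-An}\le\varepsilon\le 1-\eta$, every randomized algorithm that takes $m$ i.i.d. samples from an unknown, arbitrary distribution $P$ on $\{0,1\}^n$, and that answers "yes" with probability at least $2/3$ whenever $P$ is a degree-$d(n)$ Bayes net, and "no" with probability at least $2/3$ whenever $P$ is $\varepsilon$-far from every degree-$d(n)$ Bayes net, must use $$m\;\ge\; c\cdot\frac{2^{n/2}}{\varepsilon^2}$$ samples. Here a distribution $P$ on $\{0,1\}^n$ is a degree-$d$ Bayes net if there are a directed acyclic graph $G$ on $\{1,\dots,n\}$ in which every node $i$ has a set $\Pi_i$ of at most $d$ parents, and probability distributions $p_{i,\pi}$ on $\{0,1\}$ for each node $i$ and each $\pi\in\{0,1\}^{\Pi_i}$, such that $P(x)=\prod_{i=1}^n p_{i,x_{\Pi_i}}(x_i)$ for all $x\in\{0,1\}^n$. $P$ is $\varepsilon$-far from $Q$ if $d_{\mathrm{TV}}(P,Q)=\frac12\sum_{x\in\{0,1\}^n}|P(x)-Q(x)|\ge\varepsilon$.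 -/

import Mathlib

open Filter Asymptotics

noncomputable section

/-- The Boolean hypercube `{0,1}^n`. -/
abbrev Cube (n : ℕ) : Type := Fin n → Bool

/-- A directed graph is acyclic if no vertex can be reached from itself by a directed walk of
positive length. -/
def IsDAG {n : ℕ} (G : Digraph (Fin n)) : Prop :=
  ∀ v, ¬ Relation.TransGen G.Adj v v

/-- The parents of a node `i`: the sources of the arrows that point to `i`. -/
def parents {n : ℕ} (G : Digraph (Fin n)) (i : Fin n) : Set (Fin n) :=
  {j | G.Adj j i}

/-- `P` is Markov with respect to `G`: there are distributions `p i π` on `{0,1}`, one for each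
node `i` and each assignment `π` of bits to the parents of `i`, such that
`P x = ∏ i, p i (x restricted to the parents of i) (x i)`. -/
def IsMarkov {n : ℕ} (G : Digraph (Fin n)) (P : PMF (Cube n)) : Prop :=
  ∃ p : (i : Fin n) → (parents G i → Bool) → PMF Bool,
    ∀ x : Cube n, P x = ∏ i, p i (fun j => x j) (x i)

/-- `P` is a degree-`d` Bayes net: it is Markov with respect to some directed acyclic graph
in which every node has at most `d` parents. -/
def IsBayesNet {n : ℕ} (d : ℕ) (P : PMF (Cube n)) : Prop :=
  ∃ G : Digraph (Fin n), IsDAG G ∧ (∀ i, (parents G i).ncard ≤ d) ∧ IsMarkov G P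

/-- Total variation distance of two distributions on a finite set. -/
def tvDist {α : Type*} [Fintype α] (P Q : PMF α) : ℝ :=
  (1 / 2) * ∑ x, |(P x).toReal - (Q x).toReal|

/-- `P` is `ε`-far (in total variation distance) from every degree-`d` Bayes net. -/
def IsFarFromBayesNets {n : ℕ} (d : ℕ) (ε : ℝ) (P : PMF (Cube n)) : Prop :=
  ∀ Q : PMF (Cube n), IsBayesNet d Q → ε ≤ tvDist P Q

/-- The law of `m` i.i.d. samples from `P`. -/
def iidSamples {α : Type*} [Fintype α] (P : PMF α) (m : ℕ) : PMF (Fin m → α) :=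
  PMF.ofFintype (fun s => ∏ i, P (s i)) (by
    classical
    have h : ∑ x, P x = 1 := by rw [← tsum_fintype (L := .unconditional _)]; exact P.tsum_coe
    rw [← Fintype.piFinset_univ, Finset.sum_prod_piFinset]
    simp [h])

/-- The law of the output of a randomized algorithm `T` that is run on `m` i.i.d. samples from
`P`. For each tuple `s` of samples, `T s` is the law of the answer of the algorithm (over its
internal randomness). -/
def outputLaw {α : Type*} [Fintype α] {m : ℕ} (T : (Fin m → α) → PMF Bool) (P : PMF α) :
    PMF Bool :=
  (iidSamples P m).bind T

/-- The randomized `m`-sample algorithm `T` tests whether an arbitrary distribution on `{0,1}^n` is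
a degree-`d` Bayes net (answer `true`) or is `ε`-far from every degree-`d` Bayes net
(answer `false`), with probability of success at least `2/3` in either case. -/
def IsBayesNetTester {n m : ℕ} (d : ℕ) (ε : ℝ) (T : (Fin m → Cube n) → PMF Bool) : Prop :=
  ∀ P : PMF (Cube n),
    (IsBayesNet d P → 2 / 3 ≤ (outputLaw T P true).toReal) ∧
    (IsFarFromBayesNets d ε P → 2 / 3 ≤ (outputLaw T P false).toReal)

end

open Filter Asymptotics

noncomputable section

/-! The uniform distribution is a Bayes net, so a tester must separate it from any family of
distributions far from all Bayes nets. Identify the cube with `ι × κ`, where `κ` has constant size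
`K = 2 ^ k` and `ι` has size `B = 2 ^ (n - k)`. For a random function `z : ι → κ`, mix the uniform
distribution with weight `a` of the uniform distribution on the graph of `z`, with `a` slightly
above `ε`.

Most planted distributions are far from all Bayes nets. For a fixed `q`, the distance is a sum over
`ι` of independent bounded terms with mean at least `a * (1 - 1 / K)`, so it is substantially
smaller with probability at most `exp (-τ ^ 2 * B / 4)` (`card_planted_near_le`). Bayes nets of
degree `d` have a net of size `exp (O(n ^ 2 * 2 ^ d))` at the required precision
(`exists_finset_bayesNet_net`). As `d = o(n)`, a union bound applies.

The planted mixture is nevertheless hard to detect: its second moment relative to uniform is at most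
`exp (m ^ 2 * a ^ 4 * K ^ 2 / B)` (`sum_correlation_pow_le`, `sq_mean_sub_le_second_moment`). A
constant advantage therefore forces `m` to be at least of order `√B / (a ^ 2 * K)`. -/

theorem exp_le_add_exp_sq (x : ℝ) : Real.exp x ≤ x + Real.exp (x ^ 2) := by
  have h2 : x ^ 2 + 1 ≤ Real.exp (x ^ 2) := Real.add_one_le_exp _
  rcases le_total |x| 1 with h | h
  · have h1 := (abs_le.mp (Real.abs_exp_sub_one_sub_id_le h)).2
    linarith
  · rcases le_abs.mp h with h | h
    · have : Real.exp x ≤ Real.exp (x ^ 2) := Real.exp_le_exp.mpr (by nlinarith)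
      linarith
    · have : Real.exp x ≤ 1 := Real.exp_le_one_iff.mpr (by linarith)
      nlinarith

/-! ### Exponential moments and tails of independent sums -/

section Concentration

variable {ι κ : Type*} [Fintype ι] [Fintype κ]

/-- In `exp x ≤ x + exp (x ^ 2)` the linear term averages out for a centred `f`, which leaves a
sub-Gaussian bound. -/
theorem sum_exp_mul_le {f : κ → ℝ} {r : ℝ} (s : ℝ) (hf : ∑ v, f v = 0) (hr : ∀ v, |f v| ≤ r) :
    ∑ v, Real.exp (s * f v) ≤ Fintype.card κ * Real.exp (s ^ 2 * r ^ 2) := by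
  calc ∑ v, Real.exp (s * f v) ≤ ∑ v, (s * f v + Real.exp (s ^ 2 * r ^ 2)) := by
        refine Finset.sum_le_sum fun v _ => (exp_le_add_exp_sq _).trans ?_
        have : f v ^ 2 ≤ r ^ 2 := sq_le_sq' (abs_le.mp (hr v)).1 (abs_le.mp (hr v)).2
        gcongr
        rw [mul_pow]
        gcongr
    _ = _ := by
        rw [Finset.sum_add_distrib, ← Finset.mul_sum, hf]
        simp

/-- Independence of the coordinates factors the sum. This serves twice: for the tail bound on
distances and for the second moment of the planted mixture. -/
theorem sum_pi_exp_mul_sum_le [DecidableEq ι] {f : ι → κ → ℝ} {r : ℝ} (s : ℝ)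
    (hf : ∀ b, ∑ v, f b v = 0) (hr : ∀ b v, |f b v| ≤ r) :
    ∑ z : ι → κ, Real.exp (s * ∑ b, f b (z b)) ≤
      Fintype.card (ι → κ) * Real.exp (Fintype.card ι * (s ^ 2 * r ^ 2)) := by
  calc ∑ z : ι → κ, Real.exp (s * ∑ b, f b (z b))
      = ∏ b, ∑ v, Real.exp (s * f b v) := by
        rw [Finset.prod_univ_sum, Fintype.piFinset_univ]
        simp_rw [Finset.mul_sum, Real.exp_sum]
    _ ≤ ∏ _b : ι, (Fintype.card κ * Real.exp (s ^ 2 * r ^ 2)) :=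
        Finset.prod_le_prod (fun b _ => Finset.sum_nonneg fun v _ => (Real.exp_pos _).le)
          fun b _ => sum_exp_mul_le s (hf b) (hr b)
    _ = _ := by
        rw [Finset.prod_const, mul_pow, ← Real.exp_nat_mul]
        simp

/-- A lower-tail bound for sums of independent bounded centred variables, in counting form. -/
theorem card_sum_lt_le [DecidableEq ι] [Nonempty ι] {f : ι → κ → ℝ} {r t : ℝ} (hr0 : 0 < r)
    (ht : 0 ≤ t) (hf : ∀ b, ∑ v, f b v = 0) (hr : ∀ b v, |f b v| ≤ r) :
    ((Finset.univ.filter fun z : ι → κ => ∑ b, f b (z b) < -t).card : ℝ) ≤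
      Fintype.card (ι → κ) * Real.exp (-(t ^ 2 / (4 * (Fintype.card ι * r ^ 2)))) := by
  set n : ℝ := (Fintype.card ι : ℝ) with hn
  have hn0 : 0 < n := by rw [hn]; exact_mod_cast Fintype.card_pos
  -- The minimizer of the Chernoff exponent `n * s ^ 2 * r ^ 2 - s * t`.
  set s : ℝ := t / (2 * (n * r ^ 2)) with hs
  have hs0 : 0 ≤ s := by positivity
  have h1 : ((Finset.univ.filter fun z : ι → κ => ∑ b, f b (z b) < -t).card : ℝ) *
      Real.exp (s * t) ≤ ∑ z : ι → κ, Real.exp ((-s) * ∑ b, f b (z b)) := by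
    rw [← nsmul_eq_mul, ← Finset.sum_const]
    refine (Finset.sum_le_sum fun z hz => ?_).trans
      (Finset.sum_le_sum_of_subset_of_nonneg (Finset.filter_subset _ _)
        fun z _ _ => (Real.exp_pos _).le)
    have hz' := (Finset.mem_filter.mp hz).2
    refine Real.exp_le_exp.mpr ?_
    nlinarith
  have h2 := h1.trans (sum_pi_exp_mul_sum_le (-s) hf hr)
  rw [← le_div_iff₀ (Real.exp_pos _), mul_div_assoc, ← Real.exp_sub] at h2
  refine h2.trans (le_of_eq ?_)
  congr 2
  rw [← hn, hs]
  field_simp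
  ring

end Concentration

theorem abs_prod_sub_prod_le {ι : Type*} (s : Finset ι) {f g : ι → ℝ}
    (hf : ∀ i ∈ s, |f i| ≤ 1) (hg : ∀ i ∈ s, |g i| ≤ 1) :
    |∏ i ∈ s, f i - ∏ i ∈ s, g i| ≤ ∑ i ∈ s, |f i - g i| := by
  classical
  induction s using Finset.induction_on with
  | empty => simp
  | insert i s hi ih =>
    rw [Finset.prod_insert hi, Finset.prod_insert hi, Finset.sum_insert hi]
    have ih' := ih (fun j hj => hf j (Finset.mem_insert_of_mem hj))
      fun j hj => hg j (Finset.mem_insert_of_mem hj)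
    have hg1 : |∏ j ∈ s, g j| ≤ 1 := by
      rw [Finset.abs_prod]
      exact Finset.prod_le_one (fun _ _ => abs_nonneg _)
        fun j hj => hg j (Finset.mem_insert_of_mem hj)
    have hfi := hf i (Finset.mem_insert_self i s)
    calc |f i * ∏ j ∈ s, f j - g i * ∏ j ∈ s, g j|
        = |(f i - g i) * ∏ j ∈ s, g j + f i * (∏ j ∈ s, f j - ∏ j ∈ s, g j)| := by
          congr 1; ring
      _ ≤ |f i - g i| * |∏ j ∈ s, g j| + |f i| * |∏ j ∈ s, f j - ∏ j ∈ s, g j| := by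
          rw [← abs_mul, ← abs_mul]; exact abs_add_le _ _
      _ ≤ |f i - g i| * 1 + 1 * ∑ j ∈ s, |f j - g j| := by
          gcongr
      _ = _ := by ring

theorem abs_sub_mean_le {κ : Type*} [Fintype κ] [Nonempty κ] {h : κ → ℝ} {r : ℝ}
    (hr : ∀ v w, |h v - h w| ≤ r) (v : κ) :
    |h v - (∑ w, h w) / Fintype.card κ| ≤ r := by
  have hK : (0 : ℝ) < Fintype.card κ := by exact_mod_cast Fintype.card_pos
  have h1 : h v - (∑ w, h w) / Fintype.card κ = (∑ w, (h v - h w)) / Fintype.card κ := by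
    rw [Finset.sum_sub_distrib]
    simp
    field_simp
  rw [h1, abs_div, abs_of_pos hK, div_le_iff₀ hK]
  calc |∑ w, (h v - h w)| ≤ ∑ w, |h v - h w| := Finset.abs_sum_le_sum_abs _ _
    _ ≤ ∑ _w : κ, r := Finset.sum_le_sum fun w _ => hr v w
    _ = r * Fintype.card κ := by simp [mul_comm]

/-- Only the excess of `q` over `p` is counted; each term is then monotone and 1-Lipschitz in `p x`,
which makes moving the planted point easy to control. -/
theorem half_sum_abs_sub_eq {α : Type*} [Fintype α] {p q : α → ℝ} (h : ∑ x, p x = ∑ x, q x) :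
    (1 / 2) * ∑ x, |p x - q x| = ∑ x, max (q x - p x) 0 := by
  have h1 : ∀ x, |p x - q x| = 2 * max (q x - p x) 0 + (p x - q x) := fun x => by
    rcases le_total (q x) (p x) with h | h
    · rw [abs_of_nonneg (by linarith), max_eq_right (by linarith)]; ring
    · rw [abs_of_nonpos (by linarith), max_eq_left (by linarith)]; ring
  simp_rw [h1]
  rw [Finset.sum_add_distrib, Finset.sum_sub_distrib, h, ← Finset.mul_sum]
  ring

/-! ### The planted family: distances and correlations -/

section Planted

variable {ι κ : Type*} [Fintype κ] [DecidableEq κ]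

/-- The density, relative to the uniform distribution on `ι × κ`, of the mixture of the uniform
distribution with weight `1 - a` and the uniform distribution on the graph of `z` with weight
`a`. -/
def plantedDensity (a : ℝ) (z : ι → κ) (y : ι × κ) : ℝ :=
  1 - a + if y.2 = z y.1 then a * Fintype.card κ else 0

theorem plantedDensity_nonneg {a : ℝ} (h0 : 0 ≤ a) (h1 : a ≤ 1) (z : ι → κ) (y : ι × κ) :
    0 ≤ plantedDensity a z y := by
  unfold plantedDensity
  split_ifs
  · have : 0 ≤ a * Fintype.card κ := by positivity
    linarith
  · linarith

variable [Fintype ι]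

theorem sum_plantedDensity (a : ℝ) (z : ι → κ) :
    ∑ y, plantedDensity a z y = Fintype.card ι * Fintype.card κ := by
  rw [Fintype.sum_prod_type]
  simp only [plantedDensity, Finset.sum_add_distrib, Finset.sum_ite_eq', Finset.mem_univ,
    if_true, Finset.sum_const, Finset.card_univ, nsmul_eq_mul]
  ring

variable [DecidableEq ι] [Nonempty ι] [Nonempty κ]

/-- All but an exponentially small fraction of the planted distributions are at distance almost
`a * (1 - 1 / |κ|)` from a given distribution. -/
theorem card_planted_near_le {a τ : ℝ} (ha : 0 < a) (hτ : 0 ≤ τ)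
    {q : ι × κ → ℝ} (hq : ∑ y, q y = 1) :
    ((Finset.univ.filter fun z : ι → κ =>
      (1 / 2) * ∑ y, |plantedDensity a z y / (Fintype.card ι * Fintype.card κ) - q y| <
        a * (1 - 1 / Fintype.card κ) - τ * a).card : ℝ) ≤
      Fintype.card (ι → κ) * Real.exp (-(τ ^ 2 * Fintype.card ι / 4)) := by
  set B : ℝ := (Fintype.card ι : ℝ) with hB
  set K : ℝ := (Fintype.card κ : ℝ) with hK
  have hB0 : 0 < B := by rw [hB]; exact_mod_cast Fintype.card_pos
  have hK0 : 0 < K := by rw [hK]; exact_mod_cast Fintype.card_pos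
  set c : ℝ := (1 - a) / (B * K) with hc
  set h : ι → κ → ℝ := fun b v => ∑ w, max (q (b, w) - (c + if w = v then a / B else 0)) 0
    with hh
  set f : ι → κ → ℝ := fun b v => h b v - (∑ w, h b w) / K with hf
  have haB : 0 < a / B := by positivity
  have htv : ∀ z : ι → κ, (1 / 2) * ∑ y, |plantedDensity a z y / (B * K) - q y| =
      ∑ b, h b (z b) := fun z => by
    rw [half_sum_abs_sub_eq, Fintype.sum_prod_type]
    · refine Finset.sum_congr rfl fun b _ => Finset.sum_congr rfl fun w _ => ?_
      congr 2
      simp only [plantedDensity, hc, ← hK]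
      split_ifs
      · field_simp
      · field_simp; ring
    · rw [← Finset.sum_div, sum_plantedDensity, hq, div_self (by positivity)]
  -- Compared with no planted point, planting mass `a / B` at one point of the fibre lowers the
  -- excess by between `0` and `a / B`.
  have hosc : ∀ b v w, |h b v - h b w| ≤ a / B := by
    intro b v w
    have hup : ∀ v, h b v ≤ ∑ w, max (q (b, w) - c) 0 := fun v => by
      refine Finset.sum_le_sum fun w _ => max_le_max_right 0 ?_
      split_ifs <;> linarith
    have hlo : ∀ v, ∑ w, max (q (b, w) - c) 0 ≤ h b v + a / B := fun v => by
      have : a / B = ∑ w, if w = v then a / B else 0 := by simp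
      rw [this, hh]
      simp only
      rw [← Finset.sum_add_distrib]
      refine Finset.sum_le_sum fun w _ => ?_
      split_ifs
      · refine max_le ?_ ?_
        · linarith [le_max_left (q (b, w) - (c + a / B)) 0]
        · linarith [le_max_right (q (b, w) - (c + a / B)) 0]
      · simp
    rw [abs_le]
    constructor <;> linarith [hup v, hup w, hlo v, hlo w]
  have hmean : a * (1 - 1 / K) ≤ ∑ b, (∑ v, h b v) / K := by
    -- Bound the excess below by `0` at the planted point and by `q - c` elsewhere; each `w` is
    -- unplanted for `K - 1` of the values `v`. The total of `q - c` is `a`.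
    have h1 : ∀ b, (K - 1) * ∑ w, (q (b, w) - c) ≤ ∑ v, h b v := fun b => by
      rw [Finset.mul_sum, hh]
      simp only
      rw [Finset.sum_comm]
      refine Finset.sum_le_sum fun w _ => ?_
      have h2 : (K - 1) * (q (b, w) - c) =
          ∑ v, ((q (b, w) - c) - if w = v then (q (b, w) - c) else 0) := by
        rw [Finset.sum_sub_distrib]
        simp [hK]
        ring
      rw [h2]
      refine Finset.sum_le_sum fun v _ => ?_
      split_ifs
      · simp
      · simp
    rw [← Finset.sum_div, le_div_iff₀ hK0]
    refine le_trans (le_of_eq ?_) (Finset.sum_le_sum fun b _ => h1 b)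
    rw [← Finset.mul_sum, ← Fintype.sum_prod_type (f := fun y => q y - c),
      Finset.sum_sub_distrib, hq]
    simp only [Finset.sum_const, Finset.card_univ, Fintype.card_prod, nsmul_eq_mul, Nat.cast_mul,
      hc, ← hB, ← hK]
    field_simp
    ring
  have hfsum : ∀ b, ∑ v, f b v = 0 := fun b => by
    simp only [hf, Finset.sum_sub_distrib, Finset.sum_const, Finset.card_univ, nsmul_eq_mul, ← hK]
    field_simp
    ring
  have key := card_sum_lt_le (f := f) (r := a / B) (t := τ * a) haB (by positivity) hfsum
    fun b v => abs_sub_mean_le (hosc b) v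
  refine le_trans ?_ (key.trans (le_of_eq ?_))
  · refine Nat.cast_le.mpr (Finset.card_le_card fun z hz => ?_)
    rw [Finset.mem_filter] at hz ⊢
    refine ⟨hz.1, ?_⟩
    have h3 := hz.2
    rw [htv] at h3
    simp only [hf, Finset.sum_sub_distrib]
    linarith
  · congr 3
    rw [← hB]
    field_simp

/-- The average over `z` of the `m`-th power of the correlation of two planted densities. -/
theorem sum_correlation_pow_le {a : ℝ} (h0 : 0 ≤ a) (h1 : a ≤ 1) (m : ℕ) (z' : ι → κ) :
    ∑ z : ι → κ, ((∑ y, plantedDensity a z y * plantedDensity a z' y) /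
        (Fintype.card ι * Fintype.card κ)) ^ m ≤
      Fintype.card (ι → κ) *
        Real.exp ((m : ℝ) ^ 2 * a ^ 4 * Fintype.card κ ^ 2 / Fintype.card ι) := by
  set B : ℝ := (Fintype.card ι : ℝ) with hB
  set K : ℝ := (Fintype.card κ : ℝ) with hK
  have hB0 : 0 < B := by rw [hB]; exact_mod_cast Fintype.card_pos
  have hK1 : 1 ≤ K := by rw [hK]; exact_mod_cast Fintype.card_pos
  set f : ι → κ → ℝ := fun b v => (if v = z' b then K else 0) - 1 with hf
  have hfsum : ∀ b, ∑ v, f b v = 0 := fun b => by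
    simp [hf, Finset.sum_sub_distrib, ← hK]
  have hfr : ∀ b v, |f b v| ≤ K := fun b v => by
    simp only [hf]
    split_ifs
    · rw [abs_le]; constructor <;> linarith
    · rw [abs_le]; constructor <;> linarith
  -- The correlation depends only on where `z` and `z'` agree, and the centred agreement indicators
  -- are independent over `b`. Then `1 + x ≤ exp x` turns the `m`-th power into an exponential
  -- moment.
  have hcorr : ∀ z : ι → κ, (∑ y, plantedDensity a z y * plantedDensity a z' y) / (B * K) =
      1 + a ^ 2 / B * ∑ b, f b (z b) := fun z => by
    have hb : ∀ b, ∑ v, plantedDensity a z (b, v) * plantedDensity a z' (b, v) =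
        K + a ^ 2 * K * f b (z b) := fun b => by
      have : ∀ v, plantedDensity a z (b, v) * plantedDensity a z' (b, v) =
          (1 - a) ^ 2 + (if v = z b then (1 - a) * (a * K) else 0) +
          (if v = z' b then (1 - a) * (a * K) else 0) +
          (if v = z b then (if z b = z' b then (a * K) ^ 2 else 0) else 0) := fun v => by
        simp only [plantedDensity, ← hK]
        by_cases e1 : v = z b <;> by_cases e2 : v = z' b
        · have e3 : z b = z' b := e1.symm.trans e2
          rw [if_pos e1, if_pos e2, if_pos e1, if_pos e2, if_pos e1, if_pos e3]; ring
        · have e3 : ¬ z b = z' b := fun e => e2 (e1.trans e)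
          rw [if_pos e1, if_neg e2, if_pos e1, if_neg e2, if_pos e1, if_neg e3]; ring
        · rw [if_neg e1, if_pos e2, if_neg e1, if_pos e2, if_neg e1]; ring
        · rw [if_neg e1, if_neg e2, if_neg e1, if_neg e2, if_neg e1]; ring
      simp_rw [this]
      simp only [Finset.sum_add_distrib, Finset.sum_ite_eq', Finset.mem_univ, if_true,
        Finset.sum_const, Finset.card_univ, nsmul_eq_mul, ← hK, hf]
      split_ifs <;> ring
    rw [Fintype.sum_prod_type]
    simp_rw [hb]
    rw [Finset.sum_add_distrib, ← Finset.mul_sum]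
    simp only [Finset.sum_const, Finset.card_univ, nsmul_eq_mul, ← hB]
    field_simp
  have hle := sum_pi_exp_mul_sum_le (m * (a ^ 2 / B)) hfsum hfr
  refine le_trans (Finset.sum_le_sum fun z _ => ?_) (hle.trans (le_of_eq ?_))
  · have hnn : 0 ≤ (∑ y, plantedDensity a z y * plantedDensity a z' y) / (B * K) :=
      div_nonneg (Finset.sum_nonneg fun y _ => mul_nonneg (plantedDensity_nonneg h0 h1 _ _)
        (plantedDensity_nonneg h0 h1 _ _)) (by positivity)
    rw [mul_assoc, Real.exp_nat_mul]
    refine pow_le_pow_left₀ hnn ?_ m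
    rw [hcorr, add_comm]
    exact Real.add_one_le_exp _
  · congr 2
    rw [← hB]
    field_simp

end Planted

/-! ### A small net for the Bayes nets -/

/-- Codes for approximate degree-`d` Bayes nets: each node has a list of `d` parents and, for each
assignment of bits to them, a rounded probability. -/
abbrev NetCode (n d M : ℕ) : Type :=
  Fin n → (Fin d → Fin n) × ((Fin d → Bool) → Fin (M + 1))

def NetCode.eval {n d M : ℕ} (c : NetCode n d M) (x : Cube n) : ℝ :=
  ∏ i, if x i then (((c i).2 fun k => x ((c i).1 k) : ℕ) : ℝ) / M
    else 1 - (((c i).2 fun k => x ((c i).1 k) : ℕ) : ℝ) / M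

theorem exists_natCast_div_near {M : ℕ} (hM : 0 < M) {p : ℝ} (h0 : 0 ≤ p) (h1 : p ≤ 1) :
    ∃ t : Fin (M + 1), |p - ((t : ℕ) : ℝ) / M| ≤ 1 / M := by
  have hM' : (0 : ℝ) < M := by exact_mod_cast hM
  refine ⟨⟨⌊p * M⌋₊, Nat.lt_succ_of_le (Nat.floor_le_of_le ?_)⟩, ?_⟩
  · nlinarith
  · have e : p - (⌊p * M⌋₊ : ℝ) / M = (p * M - ⌊p * M⌋₊) / M := by field_simp
    have l1 := Nat.floor_le (show 0 ≤ p * M by positivity)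
    have l2 := Nat.lt_floor_add_one (p * M)
    simp only
    rw [e, abs_div, abs_of_nonneg (by linarith), abs_of_pos hM']
    gcongr
    linarith

theorem exists_forall_mem_exists_eq {β : Type*} [Nonempty β] [Finite β] {s : Set β} {d : ℕ}
    (h : s.ncard ≤ d) : ∃ f : Fin d → β, ∀ j ∈ s, ∃ k, f k = j := by
  classical
  have hc : Nat.card s ≤ d := by rwa [Nat.card_coe_set_eq]
  let e := Finite.equivFin s
  refine ⟨fun k => if hk : (k : ℕ) < Nat.card s then (e.symm ⟨k, hk⟩ : β)
    else Classical.arbitrary β, fun j hj => ?_⟩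
  refine ⟨⟨e ⟨j, hj⟩, (e ⟨j, hj⟩).2.trans_le hc⟩, ?_⟩
  dsimp only
  rw [dif_pos (e ⟨j, hj⟩).2, Fin.eta, Equiv.symm_apply_apply]

theorem PMF.bool_toReal_false (p : PMF Bool) : (p false).toReal = 1 - (p true).toReal := by
  have h := p.tsum_coe
  rw [tsum_fintype, Fintype.sum_bool] at h
  have h' := congrArg ENNReal.toReal h
  rw [ENNReal.toReal_add (p.apply_ne_top _) (p.apply_ne_top _), ENNReal.toReal_one] at h'
  linarith

theorem PMF.toReal_apply_le_one {α : Type*} (p : PMF α) (x : α) : (p x).toReal ≤ 1 :=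
  ENNReal.toReal_mono ENNReal.one_ne_top (p.coe_le_one x)

theorem PMF.sum_toReal {α : Type*} [Fintype α] (p : PMF α) : ∑ x, (p x).toReal = 1 := by
  have h := p.tsum_coe
  rw [tsum_fintype] at h
  rw [← ENNReal.toReal_sum fun x _ => p.apply_ne_top x, h, ENNReal.toReal_one]

/-- Each of the `n` factors is rounded with error `1 / M`, and errors add in a product of numbers in
`[-1, 1]`. Acyclicity plays no role, so codes need not define distributions. -/
theorem IsBayesNet.exists_netCode {n d M : ℕ} (hM : 0 < M) {P : PMF (Cube n)}
    (hP : IsBayesNet d P) : ∃ c : NetCode n d M, ∀ x, |(P x).toReal - c.eval x| ≤ n / M := by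
  obtain ⟨G, -, hdeg, p, hp⟩ := hP
  have hM' : (0 : ℝ) < M := by exact_mod_cast hM
  have hnode : ∀ i : Fin n, ∃ c : (Fin d → Fin n) × ((Fin d → Bool) → Fin (M + 1)),
      ∀ x : Cube n, |(p i (fun j => x j) true).toReal -
        ((c.2 fun k => x (c.1 k) : ℕ) : ℝ) / M| ≤ 1 / M := fun i => by
    have : Nonempty (Fin n) := ⟨i⟩
    obtain ⟨f, hf⟩ := exists_forall_mem_exists_eq (hdeg i)
    choose k hk using fun j : parents G i => hf j j.2
    have hr : ∀ y : Fin d → Bool, ∃ t : Fin (M + 1),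
        |(p i (fun j => y (k j)) true).toReal - ((t : ℕ) : ℝ) / M| ≤ 1 / M := fun y =>
      exists_natCast_div_near hM ENNReal.toReal_nonneg (PMF.toReal_apply_le_one _ _)
    choose t ht using hr
    refine ⟨(f, t), fun x => ?_⟩
    have := ht fun k => x (f k)
    have e : (fun j : parents G i => x (f (k j))) = fun j : parents G i => x j :=
      funext fun j => by rw [hk j]
    rwa [e] at this
  choose c hc using hnode
  refine ⟨c, fun x => ?_⟩
  rw [hp x, ENNReal.toReal_prod, NetCode.eval]
  have hrat : ∀ t : Fin (M + 1), 0 ≤ ((t : ℕ) : ℝ) / M ∧ ((t : ℕ) : ℝ) / M ≤ 1 := fun t =>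
    ⟨by positivity, (div_le_one hM').mpr (by exact_mod_cast Nat.le_of_lt_succ t.2)⟩
  refine (abs_prod_sub_prod_le _ (fun i _ => ?_) fun i _ => ?_).trans ?_
  · rw [abs_of_nonneg ENNReal.toReal_nonneg]
    exact PMF.toReal_apply_le_one _ _
  · obtain ⟨l, u⟩ := hrat ((c i).2 fun k => x ((c i).1 k))
    split_ifs <;> rw [abs_le] <;> constructor <;> linarith
  · calc _ ≤ ∑ _i : Fin n, (1 : ℝ) / M := Finset.sum_le_sum fun i _ => ?_
      _ = n / M := by simp; rfl
    have h := hc i x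
    cases hx : x i with
    | true => simpa using h
    | false =>
      rw [PMF.bool_toReal_false]
      simp only [Bool.false_eq_true, if_false]
      rw [abs_sub_comm] at h
      rwa [show ∀ p t : ℝ, 1 - p - (1 - t) = t - p from fun _ _ => by ring]

/-- The degree-`d` Bayes nets have a small net in total variation distance. -/
theorem exists_finset_bayesNet_net (n d : ℕ) {M : ℕ} (hM : 0 < M) :
    ∃ F : Finset (PMF (Cube n)), F.card ≤ (n ^ d * (M + 1) ^ 2 ^ d) ^ n ∧
      ∀ P, IsBayesNet d P → ∃ Q ∈ F, tvDist P Q ≤ 2 ^ n * n / M := by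
  classical
  let fits : NetCode n d M → PMF (Cube n) → Prop := fun c P =>
    ∀ x, |(P x).toReal - c.eval x| ≤ n / M
  -- A code is replaced by some genuine distribution near it, at the cost of doubling the error; the
  -- default value is never the one needed.
  let rep : NetCode n d M → PMF (Cube n) := fun c =>
    if h : ∃ P, fits c P then h.choose else PMF.uniformOfFintype _
  refine ⟨Finset.univ.image rep, ?_, fun P hP => ?_⟩
  · refine Finset.card_image_le.trans (le_of_eq ?_)
    simp
  · obtain ⟨c, hc⟩ := hP.exists_netCode hM
    have h : ∃ P, fits c P := ⟨P, hc⟩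
    refine ⟨rep c, Finset.mem_image_of_mem _ (Finset.mem_univ _), ?_⟩
    have hr : fits c (rep c) := by
      simp only [rep, dif_pos h]
      exact h.choose_spec
    rw [tvDist]
    calc (1 / 2 : ℝ) * ∑ x, |(P x).toReal - (rep c x).toReal|
        ≤ (1 / 2) * ∑ _x : Cube n, 2 * (n / M : ℝ) := by
          gcongr with x
          have e : (P x).toReal - (rep c x).toReal =
            ((P x).toReal - c.eval x) - ((rep c x).toReal - c.eval x) := by ring
          rw [e]
          linarith [abs_sub ((P x).toReal - c.eval x) ((rep c x).toReal - c.eval x), hc x, hr x]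
      _ = _ := by
          simp
          ring

theorem isBayesNet_uniformOfFintype (n d : ℕ) :
    IsBayesNet d (PMF.uniformOfFintype (Cube n)) := by
  refine ⟨⊥, fun v h => ?_, fun i => ?_, fun _ _ => PMF.uniformOfFintype Bool, fun x => ?_⟩
  · obtain ⟨b, -, hb⟩ := Relation.TransGen.tail'_iff.mp h
    exact hb
  · have : parents (⊥ : Digraph (Fin n)) i = ∅ := Set.eq_empty_of_forall_notMem fun j hj => hj
    simp [this]
  · simp [ENNReal.inv_pow]

theorem tvDist_triangle {α : Type*} [Fintype α] (P Q R : PMF α) :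
    tvDist P R ≤ tvDist P Q + tvDist Q R := by
  unfold tvDist
  rw [← mul_add, ← Finset.sum_add_distrib]
  gcongr with x
  exact abs_sub_le _ _ _

/-! ### Indistinguishability by the second moment -/

/-- The second-moment bound on the advantage of a test `g` in telling the product of uniform
distributions from a mixture of product distributions with densities `φ z`. -/
theorem sq_mean_sub_le_second_moment {Z α : Type*} [Fintype Z] [Nonempty Z] [Fintype α]
    [Nonempty α] {m : ℕ} {φ : Z → α → ℝ} {g : (Fin m → α) → ℝ}
    (hφ : ∀ z, ∑ x, φ z x = Fintype.card α) (hg0 : ∀ s, 0 ≤ g s) (hg1 : ∀ s, g s ≤ 1) :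
    ((∑ z, ∑ s : Fin m → α, (∏ i, φ z (s i) / Fintype.card α) * g s) / Fintype.card Z -
      ∑ s : Fin m → α, (∏ _i : Fin m, 1 / (Fintype.card α : ℝ)) * g s) ^ 2 ≤
    (∑ z, ∑ z', ((∑ x, φ z x * φ z' x) / Fintype.card α) ^ m) / Fintype.card Z ^ 2 - 1 := by
  set N : ℝ := (Fintype.card α : ℝ) with hN
  set k : ℝ := (Fintype.card Z : ℝ) with hk
  have hN0 : 0 < N := by rw [hN]; exact_mod_cast Fintype.card_pos
  have hk0 : 0 < k := by rw [hk]; exact_mod_cast Fintype.card_pos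
  -- `W` is the likelihood ratio of the mixture against uniform. The advantage is the uniform mean
  -- of `(W - 1) * g`, to which Cauchy–Schwarz applies.
  set W : (Fin m → α) → ℝ := fun s => (∑ z, ∏ i, φ z (s i)) / k with hW
  have hcard : ∑ _s : Fin m → α, (1 : ℝ) = N ^ m := by simp [hN]
  have hWsum : ∑ s, W s = N ^ m := by
    simp only [hW]
    rw [← Finset.sum_div, Finset.sum_comm]
    simp_rw [← Fintype.sum_pow, hφ]
    simp [← hk]
    field_simp
  have hWsq : ∑ s, W s ^ 2 = N ^ m *
      ((∑ z, ∑ z', ((∑ x, φ z x * φ z' x) / N) ^ m) / k ^ 2) := by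
    simp only [hW, div_pow]
    rw [← Finset.sum_div, mul_div_assoc']
    congr 1
    simp_rw [sq, Finset.sum_mul_sum, ← Finset.prod_mul_distrib]
    rw [Finset.sum_comm, Finset.mul_sum]
    refine Finset.sum_congr rfl fun z _ => ?_
    rw [Finset.sum_comm, Finset.mul_sum]
    refine Finset.sum_congr rfl fun z' _ => ?_
    rw [← Fintype.sum_pow (fun x => φ z x * φ z' x)]
    field_simp
  have hdiff : (∑ z, ∑ s : Fin m → α, (∏ i, φ z (s i) / N) * g s) / k -
      ∑ s : Fin m → α, (∏ _i : Fin m, 1 / N) * g s =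
      (N ^ m)⁻¹ * ∑ s, (W s - 1) * g s := by
    rw [Finset.sum_comm, Finset.sum_div, ← Finset.sum_sub_distrib, Finset.mul_sum]
    refine Finset.sum_congr rfl fun s _ => ?_
    simp only [hW, Finset.prod_div_distrib, Finset.prod_const, Finset.card_univ, Fintype.card_fin,
      one_pow, ← Finset.sum_mul, ← Finset.sum_div]
    field_simp
  rw [hdiff, mul_pow]
  have hcs := Finset.sum_mul_sq_le_sq_mul_sq Finset.univ (fun s => W s - 1) g
  have hg2 : ∑ s, g s ^ 2 ≤ N ^ m := by
    rw [← hcard]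
    exact Finset.sum_le_sum fun s _ => pow_le_one₀ (hg0 s) (hg1 s)
  have hW2 : ∑ s, (W s - 1) ^ 2 = N ^ m *
      ((∑ z, ∑ z', ((∑ x, φ z x * φ z' x) / N) ^ m) / k ^ 2 - 1) := by
    have : ∀ s, (W s - 1) ^ 2 = W s ^ 2 - 2 * W s + 1 := fun s => by ring
    simp_rw [this]
    rw [Finset.sum_add_distrib, Finset.sum_sub_distrib, ← Finset.mul_sum, hWsum, hWsq, hcard]
    ring
  have hle : (∑ s, (W s - 1) * g s) ^ 2 ≤ N ^ m *
      ((∑ z, ∑ z', ((∑ x, φ z x * φ z' x) / N) ^ m) / k ^ 2 - 1) * N ^ m := by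
    rw [← hW2]
    exact hcs.trans (mul_le_mul_of_nonneg_left hg2 (Finset.sum_nonneg fun s _ => sq_nonneg _))
  have hNm : 0 < N ^ m := by positivity
  rw [inv_pow, inv_mul_le_iff₀ (by positivity)]
  linarith

theorem outputLaw_toReal {α : Type*} [Fintype α] {m : ℕ} (T : (Fin m → α) → PMF Bool)
    (P : PMF α) (b : Bool) : (outputLaw T P b).toReal =
      ∑ s : Fin m → α, (∏ i, (P (s i)).toReal) * (T s b).toReal := by
  rw [outputLaw, PMF.bind_apply, tsum_fintype, ENNReal.toReal_sum]
  · refine Finset.sum_congr rfl fun s _ => ?_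
    rw [ENNReal.toReal_mul, iidSamples, PMF.ofFintype_apply, ENNReal.toReal_prod]
  · intro s _
    exact ENNReal.mul_ne_top (PMF.apply_ne_top _ _) (PMF.apply_ne_top _ _)

section PlantedPMF

variable {α ι κ : Type*} [Fintype α] [Fintype ι] [Fintype κ] [DecidableEq κ]
  [Nonempty ι] [Nonempty κ]

/-- The planted distribution, transported along a bijection `e`. -/
def plantedPMF (e : α ≃ ι × κ) {a : ℝ} (h0 : 0 ≤ a) (h1 : a ≤ 1) (z : ι → κ) : PMF α :=
  PMF.ofFintype (fun x => ENNReal.ofReal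
    (plantedDensity a z (e x) / (Fintype.card ι * Fintype.card κ))) (by
    rw [← ENNReal.ofReal_sum_of_nonneg fun x _ =>
      div_nonneg (plantedDensity_nonneg h0 h1 _ _) (by positivity),
      e.sum_comp fun y => plantedDensity a z y / (Fintype.card ι * Fintype.card κ : ℝ),
      ← Finset.sum_div, sum_plantedDensity, div_self (by simp), ENNReal.ofReal_one])

theorem plantedPMF_toReal (e : α ≃ ι × κ) {a : ℝ} (h0 : 0 ≤ a) (h1 : a ≤ 1) (z : ι → κ) (x : α) :
    (plantedPMF e h0 h1 z x).toReal =
      plantedDensity a z (e x) / (Fintype.card ι * Fintype.card κ) := by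
  rw [plantedPMF, PMF.ofFintype_apply, ENNReal.toReal_ofReal
    (div_nonneg (plantedDensity_nonneg h0 h1 _ _) (by positivity))]

variable [DecidableEq ι]

theorem card_tvDist_planted_lt_le (e : α ≃ ι × κ) {a τ : ℝ} (h0 : 0 < a) (h1 : a ≤ 1)
    (hτ : 0 ≤ τ) (Q : PMF α) :
    ((Finset.univ.filter fun z : ι → κ => tvDist (plantedPMF e h0.le h1 z) Q <
        a * (1 - 1 / Fintype.card κ) - τ * a).card : ℝ) ≤
      Fintype.card (ι → κ) * Real.exp (-(τ ^ 2 * Fintype.card ι / 4)) := by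
  have hq : ∑ y, (Q (e.symm y)).toReal = 1 := by
    rw [e.symm.sum_comp fun x => (Q x).toReal, Q.sum_toReal]
  convert card_planted_near_le h0 hτ hq using 5 with z
  rw [tvDist, ← e.sum_comp]
  simp_rw [plantedPMF_toReal, Equiv.symm_apply_apply]

/-- The number of samples needed to tell the uniform distribution from most of the planted
distributions. -/
theorem one_div_le_of_distinguishes (e : α ≃ ι × κ) {a : ℝ} (h0 : 0 ≤ a) (h1 : a ≤ 1) {m : ℕ}
    (T : (Fin m → α) → PMF Bool) [Nonempty α]
    (hU : 2 / 3 ≤ (outputLaw T (PMF.uniformOfFintype α) true).toReal)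
    (hfar : (3 / 4 : ℝ) * Fintype.card (ι → κ) ≤ (Finset.univ.filter fun z : ι → κ =>
      2 / 3 ≤ (outputLaw T (plantedPMF e h0 h1 z) false).toReal).card) :
    1 / 37 ≤ (m : ℝ) ^ 2 * a ^ 4 * Fintype.card κ ^ 2 / Fintype.card ι := by
  have hcard : (Fintype.card α : ℝ) = Fintype.card ι * Fintype.card κ := by
    rw [Fintype.card_congr e, Fintype.card_prod, Nat.cast_mul]
  have hZ : (0 : ℝ) < Fintype.card (ι → κ) := by exact_mod_cast Fintype.card_pos
  have hmom := sq_mean_sub_le_second_moment (m := m)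
    (φ := fun (z : ι → κ) x => plantedDensity a z (e x)) (g := fun s => (T s false).toReal)
    (fun z => by rw [e.sum_comp, sum_plantedDensity, hcard])
    (fun s => ENNReal.toReal_nonneg) (fun s => PMF.toReal_apply_le_one _ _)
  have hcorr : ∑ z : ι → κ, ∑ z' : ι → κ, ((∑ x, plantedDensity a z (e x) *
      plantedDensity a z' (e x)) / Fintype.card α) ^ m ≤ (Fintype.card (ι → κ) : ℝ) ^ 2 *
        Real.exp ((m : ℝ) ^ 2 * a ^ 4 * Fintype.card κ ^ 2 / Fintype.card ι) := by
    rw [Finset.sum_comm]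
    calc _ ≤ ∑ _z : ι → κ, _ := Finset.sum_le_sum fun z' _ => by
          have := sum_correlation_pow_le h0 h1 m z'
          simp_rw [← e.sum_comp fun y => plantedDensity a _ y * plantedDensity a z' y,
            ← hcard] at this
          exact this
      _ = _ := by
          rw [Finset.sum_const, Finset.card_univ, nsmul_eq_mul]
          ring
  have hunif : ∑ s : Fin m → α, (∏ _i : Fin m, 1 / (Fintype.card α : ℝ)) * (T s false).toReal
      ≤ 1 / 3 := by
    have h := outputLaw_toReal T (PMF.uniformOfFintype α) false
    simp only [PMF.uniformOfFintype_apply, ENNReal.toReal_inv, ENNReal.toReal_natCast] at h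
    simp only [one_div]
    rw [← h, PMF.bool_toReal_false]
    linarith
  have hmix : 1 / 2 ≤ (∑ z : ι → κ, ∑ s : Fin m → α,
      (∏ i, plantedDensity a z (e (s i)) / Fintype.card α) * (T s false).toReal) /
        Fintype.card (ι → κ) := by
    rw [le_div_iff₀ hZ]
    have h : ∀ z : ι → κ, ∑ s : Fin m → α, (∏ i, plantedDensity a z (e (s i)) /
        Fintype.card α) * (T s false).toReal =
        (outputLaw T (plantedPMF e h0 h1 z) false).toReal := fun z => by
      rw [outputLaw_toReal, hcard]
      simp_rw [plantedPMF_toReal]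
    simp_rw [h]
    calc _ ≤ ∑ z ∈ Finset.univ.filter fun z : ι → κ =>
            2 / 3 ≤ (outputLaw T (plantedPMF e h0 h1 z) false).toReal, (2 / 3 : ℝ) := by
          rw [Finset.sum_const, nsmul_eq_mul]
          linarith
      _ ≤ ∑ z ∈ Finset.univ.filter fun z : ι → κ =>
            2 / 3 ≤ (outputLaw T (plantedPMF e h0 h1 z) false).toReal,
            (outputLaw T (plantedPMF e h0 h1 z) false).toReal :=
          Finset.sum_le_sum fun z hz => (Finset.mem_filter.mp hz).2
      _ ≤ _ := Finset.sum_le_sum_of_subset_of_nonneg (Finset.filter_subset _ _)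
          fun z _ _ => ENNReal.toReal_nonneg
  -- The test answers `false` with mean probability at least `3/4 * 2/3 = 1/2` on the mixture and at
  -- most `1/3` on uniform, so the squared advantage is at least `1/36`.
  have hexp : 37 / 36 ≤ Real.exp ((m : ℝ) ^ 2 * a ^ 4 * Fintype.card κ ^ 2 / Fintype.card ι) := by
    have h := (div_le_iff₀' (by positivity)).mpr hcorr
    have hsq := pow_le_pow_left₀ (by norm_num) (sub_le_sub hmix hunif) 2
    have h2 := hsq.trans hmom
    linarith
  by_contra! hlt
  have h3 := Real.add_one_le_exp
    (-((m : ℝ) ^ 2 * a ^ 4 * Fintype.card κ ^ 2 / Fintype.card ι))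
  rw [Real.exp_neg] at h3
  have h4 := inv_anti₀ (by norm_num) hexp
  norm_num at h4
  linarith

end PlantedPMF

/-! ### Union bound over the net and choice of parameters -/

theorem IsBayesNetTester.one_div_le {n k d M m : ℕ} (hk : k ≤ n) (hM : 0 < M) {a τ ε : ℝ}
    (h0 : 0 < a) (h1 : a ≤ 1) (hτ : 0 ≤ τ)
    (hε : ε ≤ a * (1 - 1 / 2 ^ k) - τ * a - 2 ^ n * n / M)
    (hF : (((n ^ d * (M + 1) ^ 2 ^ d) ^ n : ℕ) : ℝ) * Real.exp (-(τ ^ 2 * 2 ^ (n - k) / 4)) ≤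
      1 / 4)
    {T : (Fin m → Cube n) → PMF Bool} (hT : IsBayesNetTester d ε T) :
    1 / 37 ≤ (m : ℝ) ^ 2 * a ^ 4 * (2 ^ k) ^ 2 / 2 ^ (n - k) := by
  classical
  -- Any bijection will do: the net enters only through its size.
  let e : Cube n ≃ Cube (n - k) × Cube k := Fintype.equivOfCardEq (by
    simp [← pow_add, Nat.sub_add_cancel hk])
  obtain ⟨F, hFcard, hFnet⟩ := exists_finset_bayesNet_net n d hM
  have hι : (Fintype.card (Cube (n - k)) : ℝ) = 2 ^ (n - k) := by simp
  have hκ : (Fintype.card (Cube k) : ℝ) = 2 ^ k := by simp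
  set near : PMF (Cube n) → Finset (Cube (n - k) → Cube k) := fun Q =>
    Finset.univ.filter fun z => tvDist (plantedPMF e h0.le h1 z) Q <
      a * (1 - 1 / Fintype.card (Cube k)) - τ * a with hnear
  have hbad : ((F.biUnion near).card : ℝ) ≤
      1 / 4 * Fintype.card (Cube (n - k) → Cube k) := by
    calc ((F.biUnion near).card : ℝ) ≤ ∑ Q ∈ F, ((near Q).card : ℝ) := by
          exact_mod_cast Finset.card_biUnion_le
      _ ≤ ∑ _Q ∈ F, _ := Finset.sum_le_sum fun Q _ => card_tvDist_planted_lt_le e h0 h1 hτ Q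
      _ = (F.card : ℝ) * Real.exp (-(τ ^ 2 * 2 ^ (n - k) / 4)) *
            Fintype.card (Cube (n - k) → Cube k) := by
          rw [Finset.sum_const, nsmul_eq_mul, hι]
          ring
      _ ≤ _ := by
          gcongr
          refine le_trans ?_ hF
          gcongr
  have hgood : (F.biUnion near)ᶜ ⊆ Finset.univ.filter fun z =>
      2 / 3 ≤ (outputLaw T (plantedPMF e h0.le h1 z) false).toReal := fun z hz => by
    refine Finset.mem_filter.mpr ⟨Finset.mem_univ _, (hT _).2 fun Q hQ => ?_⟩
    obtain ⟨Q', hQ', hdist⟩ := hFnet Q hQ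
    have hz' : z ∉ near Q' := fun h =>
      Finset.mem_compl.mp hz (Finset.mem_biUnion.mpr ⟨Q', hQ', h⟩)
    simp only [hnear, Finset.mem_filter, Finset.mem_univ, true_and, not_lt, hκ] at hz'
    linarith [tvDist_triangle (plantedPMF e h0.le h1 z) Q Q']
  have hmany : (3 / 4 : ℝ) * Fintype.card (Cube (n - k) → Cube k) ≤
      (Finset.univ.filter fun z =>
        2 / 3 ≤ (outputLaw T (plantedPMF e h0.le h1 z) false).toReal).card := by
    refine le_trans ?_ (Nat.cast_le.mpr (Finset.card_le_card hgood))
    rw [Finset.card_compl, Nat.cast_sub (Finset.card_le_univ _)]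
    linarith
  have h := one_div_le_of_distinguishes e h0.le h1 T
    ((hT _).1 (isBayesNet_uniformOfFintype n d)) hmany
  rwa [hι, hκ] at h

theorem two_pow_le_exp (j : ℕ) : (2 : ℝ) ^ j ≤ Real.exp j := by
  rw [← mul_one (j : ℝ), Real.exp_nat_mul]
  gcongr
  linarith [Real.add_one_le_exp (1 : ℝ)]

/-- The logarithm of the number of codes of degree-`d` Bayes nets with `M` rounding levels is
at most of order `n ^ 2 * 2 ^ d` if `log M` is of order `n`. -/
theorem natCast_card_codes_le {n d M C : ℕ} (hM : ((M + 1 : ℕ) : ℝ) ≤ Real.exp (C * n)) :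
    (((n ^ d * (M + 1) ^ 2 ^ d) ^ n : ℕ) : ℝ) ≤ Real.exp ((C + 1) * n ^ 2 * 2 ^ d) := by
  have hn : (n : ℝ) ≤ Real.exp n := by linarith [Real.add_one_le_exp (n : ℝ)]
  have hd : (d : ℝ) ≤ 2 ^ d := by exact_mod_cast Nat.lt_two_pow_self.le
  rw [Nat.cast_pow, Nat.cast_mul, Nat.cast_pow, Nat.cast_pow (M + 1)]
  calc (((n : ℝ) ^ d * ((M + 1 : ℕ) : ℝ) ^ 2 ^ d) ^ n)
      ≤ (Real.exp n ^ d * Real.exp (C * n) ^ 2 ^ d) ^ n := by gcongr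
    _ = Real.exp (n * (d * n + 2 ^ d * (C * n))) := by
        rw [← Real.exp_nat_mul, ← Real.exp_nat_mul, ← Real.exp_add, ← Real.exp_nat_mul]
        push_cast
        rfl
    _ ≤ _ := by
        refine Real.exp_le_exp.mpr ?_
        have : (n : ℝ) ^ 2 * d ≤ n ^ 2 * 2 ^ d := by gcongr
        linarith

/-- Eventually `2 * d n ≤ n`, so `2 ^ d n ≤ √2 ^ n`, and `n ^ 2 * √2 ^ n` is negligible against `2 ^
n`. The extra `2` yields a failure bound `exp (-2) ≤ 1/4`. -/
theorem eventually_mul_sq_mul_two_pow_le {d : ℕ → ℕ}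
    (hd : (fun n : ℕ => (d n : ℝ)) =o[atTop] fun n : ℕ => (n : ℝ)) (C : ℝ) {c : ℝ} (hC : 0 ≤ C)
    (hc : 0 < c) : ∀ᶠ n : ℕ in atTop, C * (n : ℝ) ^ 2 * 2 ^ d n + 2 ≤ c * 2 ^ n := by
  have hlim := (tendsto_pow_const_div_const_pow_of_one_lt 2
    (show (1 : ℝ) < √2 by rw [Real.lt_sqrt] <;> norm_num)).eventually_lt_const
    (show 0 < c / (2 * (C + 1)) by positivity)
  have hlim2 := (tendsto_pow_atTop_atTop_of_one_lt (one_lt_two (α := ℝ))).eventually_ge_atTop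
    (2 * (2 / c))
  filter_upwards [hd.bound (show (0 : ℝ) < 1 / 2 by norm_num), hlim, hlim2] with n h1 h2 h3
  have hdn : 2 * d n ≤ n := by
    have : (2 * d n : ℝ) ≤ n := by
      simp only [Real.norm_natCast] at h1
      linarith
    exact_mod_cast this
  have hsq : (√2 : ℝ) ^ n * √2 ^ n = 2 ^ n := by
    rw [← mul_pow, Real.mul_self_sqrt (by norm_num)]
  have h4 : (2 : ℝ) ^ d n ≤ √2 ^ n := by
    calc (2 : ℝ) ^ d n = √2 ^ (2 * d n) := by rw [pow_mul, Real.sq_sqrt (by norm_num)]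
      _ ≤ √2 ^ n := pow_le_pow_right₀ (by rw [Real.le_sqrt] <;> norm_num) hdn
  have hpos : (0 : ℝ) < √2 ^ n := by positivity
  rw [div_lt_div_iff₀ hpos (by positivity)] at h2
  rw [← mul_div_assoc, div_le_iff₀ hc] at h3
  have h5 : C * (n : ℝ) ^ 2 * 2 ^ d n ≤ (C + 1) * n ^ 2 * √2 ^ n := by gcongr; linarith
  have h6 := mul_le_mul_of_nonneg_right h2.le hpos.le
  rw [mul_assoc c, hsq] at h6
  linarith

theorem corollaryB2 (η : ℝ) (hη : 0 < η) :
    ∃ c : ℝ, 0 < c ∧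
      ∀ (A : ℝ) (d : ℕ → ℕ),
        ((fun n : ℕ => (d n : ℝ)) =o[atTop] fun n : ℕ => (n : ℝ)) →
        ∀ᶠ n : ℕ in atTop, ∀ ε : ℝ, (2 : ℝ) ^ (-(A * (n : ℝ))) ≤ ε → ε ≤ 1 - η →
          ∀ (m : ℕ) (T : (Fin m → Cube n) → PMF Bool), IsBayesNetTester (d n) ε T →
            c * ((2 : ℝ) ^ ((n : ℝ) / 2) / ε ^ 2) ≤ (m : ℝ) := by
  obtain ⟨k, hk⟩ := pow_unbounded_of_one_lt (16 / η) (one_lt_two (α := ℝ))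
  have hK : (0 : ℝ) < 2 ^ k := by positivity
  have hKη : 1 / 2 ^ k ≤ η / 16 := by
    rw [div_lt_iff₀ hη] at hk
    rw [div_le_div_iff₀ hK (by norm_num)]
    linarith
  refine ⟨1 / (40 * (2 ^ k) ^ 2), by positivity, fun A d hd => ?_⟩
  set D : ℕ := ⌈A⌉₊ with hD
  set C : ℕ := 3 + D + k with hC
  filter_upwards [eventually_mul_sq_mul_two_pow_le hd (C + 1 : ℝ) (by positivity)
    (show 0 < (η / 8) ^ 2 / (4 * 2 ^ k) by positivity), eventually_ge_atTop k,
    eventually_ge_atTop 1] with n hn hkn hn1 ε hεlo hεhi m T hT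
  have hε0 : 0 < ε := lt_of_lt_of_le (by positivity) hεlo
  have hη1 : η < 1 := by linarith
  have hn0 : (1 : ℝ) ≤ n := by exact_mod_cast hn1
  have hεD : ((2 : ℝ) ^ (D * n))⁻¹ ≤ ε := by
    refine le_trans ?_ hεlo
    rw [← Real.rpow_natCast, ← Real.rpow_neg (by norm_num)]
    refine Real.rpow_le_rpow_of_exponent_le (by norm_num) (neg_le_neg ?_)
    push_cast
    gcongr
    exact Nat.le_ceil A
  -- Makes the rounding error `2 ^ n * n / M` equal to `2 ^ (-D * n) * 2 ^ (-k) ≤ ε * (η / 16)`,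
  -- while `log M` stays linear in `n`; this is where `2 ^ (-A * n) ≤ ε` is needed.
  set M : ℕ := n * 2 ^ (n + D * n + k) with hMdef
  have hM0 : 0 < M := by positivity
  have hMexp : ((M + 1 : ℕ) : ℝ) ≤ Real.exp (C * n) := by
    have h2M : M + 1 ≤ n * 2 ^ (n + D * n + k + 1) := by
      rw [pow_succ, ← mul_assoc]
      omega
    calc ((M + 1 : ℕ) : ℝ) ≤ n * 2 ^ (n + D * n + k + 1) := by exact_mod_cast h2M
      _ ≤ Real.exp n * Real.exp (n + D * n + k + 1 : ℕ) := by
          gcongr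
          · linarith [Real.add_one_le_exp (n : ℝ)]
          · exact two_pow_le_exp _
      _ ≤ _ := by
          rw [← Real.exp_add]
          refine Real.exp_le_exp.mpr ?_
          rw [hC]
          push_cast
          nlinarith [(Nat.cast_nonneg k : (0 : ℝ) ≤ k)]
  have hpowsub : (2 : ℝ) ^ (n - k) = 2 ^ n / 2 ^ k := by
    rw [eq_div_iff hK.ne', ← pow_add, Nat.sub_add_cancel hkn]
  -- The relative losses `η / 16` from `1 / K`, `η / 8` from `τ` and at most `η / 16` from rounding
  -- total at most `η / 4`, within the slack `η / 2`. The bound `ε ≤ 1 - η` keeps `a ≤ 1`.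
  set a : ℝ := ε / (1 - η / 2) with ha
  have hη2 : 0 < 1 - η / 2 := by linarith
  have ha0 : 0 < a := by positivity
  have ha1 : a ≤ 1 := by rw [ha, div_le_one hη2]; linarith
  have haε : a * (1 - η / 2) = ε := div_mul_cancel₀ ε hη2.ne'
  have ha2 : a ≤ 2 * ε := by nlinarith
  have hround : (2 : ℝ) ^ n * n / M ≤ ε * (η / 16) := by
    have : (2 : ℝ) ^ n * n / M = (2 ^ (D * n))⁻¹ * (1 / 2 ^ k) := by
      rw [hMdef]
      push_cast
      rw [pow_add, pow_add]
      field_simp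
    rw [this]
    gcongr
  have hmain := hT.one_div_le (M := M) (τ := η / 8) hkn hM0 ha0 ha1 (by positivity) ?_ ?_
  · by_contra! hlt
    rw [← mul_div_assoc, lt_div_iff₀ (by positivity)] at hlt
    have hsq := pow_lt_pow_left₀ hlt (by positivity) two_ne_zero
    have hrt : ((2 : ℝ) ^ ((n : ℝ) / 2)) ^ 2 = 2 ^ n := by
      rw [← Real.rpow_natCast, ← Real.rpow_mul (by norm_num), ← Real.rpow_natCast]
      congr 1
      push_cast
      ring
    rw [mul_pow _ ((2 : ℝ) ^ ((n : ℝ) / 2)), hrt] at hsq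
    have h4 : a ^ 4 ≤ (2 * ε) ^ 4 := by gcongr
    have hN : (0 : ℝ) < 2 ^ n := by positivity
    have hK1 : (1 : ℝ) ≤ 2 ^ k := one_le_pow₀ (by norm_num)
    rw [hpowsub, le_div_iff₀ (by positivity)] at hmain
    have h5 : (m : ℝ) ^ 2 * a ^ 4 * (2 ^ k) ^ 2 ≤ 16 * (2 ^ k) ^ 2 * ((m * ε ^ 2) ^ 2) := by
      calc _ ≤ (m : ℝ) ^ 2 * (2 * ε) ^ 4 * (2 ^ k) ^ 2 := by gcongr
        _ = _ := by ring
    have h6 : 16 * (2 ^ k) ^ 2 * ((m * ε ^ 2) ^ 2) <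
        16 * (2 ^ k) ^ 2 * ((1 / (40 * (2 ^ k) ^ 2)) ^ 2 * 2 ^ n) := by gcongr
    have h7 : (16 : ℝ) * (2 ^ k) ^ 2 * ((1 / (40 * (2 ^ k) ^ 2)) ^ 2 * 2 ^ n) =
        1 / 100 * (2 ^ n / 2 ^ k) * (1 / 2 ^ k) := by
      field_simp
      norm_num
    have h8 : 1 / 100 * ((2 : ℝ) ^ n / 2 ^ k) * (1 / 2 ^ k) ≤
        1 / 100 * ((2 : ℝ) ^ n / 2 ^ k) * 1 := by
      gcongr
      rw [div_le_one hK]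
      exact hK1
    have h9 : 0 < (2 : ℝ) ^ n / 2 ^ k := by positivity
    linarith
  · have h1 : a * (1 / 2 ^ k) ≤ a * (η / 16) := by gcongr
    have h2 : ε * (η / 16) ≤ a * (η / 16) := by
      gcongr
      nlinarith
    nlinarith
  · calc _ ≤ Real.exp ((C + 1) * n ^ 2 * 2 ^ d n) *
          Real.exp (-((η / 8) ^ 2 * 2 ^ (n - k) / 4)) := by
          gcongr
          exact natCast_card_codes_le hMexp
      _ ≤ Real.exp (-2) := by
          rw [← Real.exp_add, hpowsub]
          refine Real.exp_le_exp.mpr ?_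
          have : (η / 8) ^ 2 * (2 ^ n / 2 ^ k) / 4 = (η / 8) ^ 2 / (4 * 2 ^ k) * 2 ^ n := by
            field_simp
          linarith
      _ ≤ 1 / 4 := by
          rw [Real.exp_neg, one_div]
          refine inv_anti₀ (by norm_num) ?_
          have := two_pow_le_exp 2
          norm_num at this
          exact this

end
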